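/- Let $(M^m,g)$ and $(N^n,h)$ be smooth Riemannian manifolds (finite-dimensional, Hausdorff, without boundary) and let $\varphi : M \to N$ be a smooth map. Let $\tau(\varphi)=\operatorname{Trace}_g\nabla d\varphi$ be its tension field and $$\tau_2(\varphi)=\operatorname{Trace}_g\big(\nabla^{\varphi}\nabla^{\varphi}-\nabla^{\varphi}_{\nabla^{M}}\big)\tau(\varphi)-\operatorname{Trace}_g R^{N}(d\varphi,\tau(\varphi))\,d\varphi$$ its bitension field, where $R^N(X,Y)Z=\nabla^N_X\nabla^N_YZ-\nabla^N_Y\nabla^N_XZ-\nabla^N_{[X,Y]}Z$ and $\nabla^\varphi$ is the pull-back connection on $\varphi^{-1}TN$. The map $\varphi$ is called harmonic if $\tau(\varphi)=0$ on $M$. For a smooth function $f : M \to (0,\infty)$ it is called $f$-biharmonic if it satisfies the Euler-Lagrange equation of the $f$-bienergy $\tfrac12\int f\,|\tau(\varphi)|^2 v_g$, that is $$\tau_{2,f}(\varphi):=f\,\tau_2(\varphi)+(\Delta f)\,\tau(\varphi)+2\,\nabla^{\varphi}_{\operatorname{grad} f}\,\tau(\varphi)=0\quad\text{on } M,$$ where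 $\Delta$ is the Laplace-Beltrami operator of $g$ (the trace of the Hessian). Then $\varphi$ is harmonic if and only if it is $f$-biharmonic for every smooth function $f : M \to (0,\infty)$. -/

import Mathlib

open scoped Manifold ContDiff

noncomputable section

namespace FBiharmonic

/-- The coordinate space `ℝᵐ`. -/
abbrev Coord (m : ℕ) : Type := EuclideanSpace ℝ (Fin m)

/-- A smooth (`C^∞`) Riemannian metric on the `m`-dimensional manifold `M`. -/
abbrev SmoothMetric (m : ℕ) (M : Type*) [TopologicalSpace M] [ChartedSpace (Coord m) M]
    [IsManifold (𝓡 m) ∞ M] : Type _ :=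
  Bundle.ContMDiffRiemannianMetric (𝓡 m) ∞ (Coord m) (fun p : M => TangentSpace (𝓡 m) p)

/-- The partial derivative `∂u/∂xⁱ` at `x`, for `u` defined near `x` in `ℝᵐ`. -/
def pd {m : ℕ} (i : Fin m) (u : Coord m → ℝ) (x : Coord m) : ℝ :=
  fderiv ℝ u x (EuclideanSpace.single i 1)

section OneManifold

variable {m : ℕ} {M : Type*} [TopologicalSpace M] [ChartedSpace (Coord m) M]
  [IsManifold (𝓡 m) ∞ M]

/-- The coordinate vector `∂/∂xⁱ ∈ T_q M` of the preferred chart around `p`, for `q` in the domain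
of that chart. -/
def coordVec (p q : M) (i : Fin m) : TangentSpace (𝓡 m) q :=
  (trivializationAt (Coord m) (TangentSpace (𝓡 m) : M → Type _) p).symmL ℝ q
    (EuclideanSpace.single i (1 : ℝ))

/-- The `i`-th component of `v ∈ T_q M` with respect to the coordinate vectors `∂/∂xⁱ` of the
preferred chart around `p`, for `q` in the domain of that chart. -/
def comp (p q : M) (v : TangentSpace (𝓡 m) q) (i : Fin m) : ℝ :=
  ((trivializationAt (Coord m) (TangentSpace (𝓡 m) : M → Type _) p).continuousLinearMapAt ℝ q v :
    Coord m) i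

/-- The matrix `(g_ij)` of the metric in the chart around `p`, as a function of the coordinates. -/
def gLow (g : SmoothMetric m M) (p : M) (x : Coord m) : Matrix (Fin m) (Fin m) ℝ :=
  Matrix.of fun i j =>
    g.inner ((extChartAt (𝓡 m) p).symm x)
      (coordVec p ((extChartAt (𝓡 m) p).symm x) i) (coordVec p ((extChartAt (𝓡 m) p).symm x) j)

/-- The inverse matrix `(g^ij)` of the metric in the chart around `p`. -/
def gUp (g : SmoothMetric m M) (p : M) (x : Coord m) : Matrix (Fin m) (Fin m) ℝ :=
  (gLow g p x)⁻¹

/-- The Christoffel symbols `Γᵏ_ij` of the Levi-Civita connection in the chart around `p`: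
`Γᵏ_ij = ½ ∑_l g^kl (∂_i g_jl + ∂_j g_il - ∂_l g_ij)`. -/
def christoffel (g : SmoothMetric m M) (p : M) (k i j : Fin m) (x : Coord m) : ℝ :=
  (1 / 2 : ℝ) * ∑ l, gUp g p x k l *
    (pd i (fun y => gLow g p y j l) x + pd j (fun y => gLow g p y i l) x
      - pd l (fun y => gLow g p y i j) x)

/-- The components `Rᵃ_dbc` of the curvature in the chart around `p`, where
`R(∂_b, ∂_c) ∂_d = ∑_a Rᵃ_dbc ∂_a` and
`Rᵃ_dbc = ∂_b Γᵃ_cd - ∂_c Γᵃ_bd + ∑_e (Γᵃ_be Γᵉ_cd - Γᵃ_ce Γᵉ_bd)`. -/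
def curvCoeff (g : SmoothMetric m M) (p : M) (a b c d : Fin m) (x : Coord m) : ℝ :=
  pd b (christoffel g p a c d) x - pd c (christoffel g p a b d) x
    + ∑ e, (christoffel g p a b e x * christoffel g p e c d x
      - christoffel g p a c e x * christoffel g p e b d x)

/-- The curvature operator `R(X,Y)Z = ∇_X ∇_Y Z - ∇_Y ∇_X Z - ∇_[X,Y] Z` on `T_p M`. -/
def curvature (g : SmoothMetric m M) (p : M) (X Y Z : TangentSpace (𝓡 m) p) :
    TangentSpace (𝓡 m) p :=
  ∑ a, (∑ b, ∑ c, ∑ d, curvCoeff g p a b c d (extChartAt (𝓡 m) p p)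
    * comp p p X b * comp p p Y c * comp p p Z d) • coordVec p p a

/-- The gradient: `grad f = ∑_ij g^ij (∂_j f) ∂_i`. -/
def grad (g : SmoothMetric m M) (f : M → ℝ) (p : M) : TangentSpace (𝓡 m) p :=
  ∑ i, (∑ j, gUp g p (extChartAt (𝓡 m) p p) i j
    * pd j (f ∘ (extChartAt (𝓡 m) p).symm) (extChartAt (𝓡 m) p p)) • coordVec p p i

/-- The Laplace-Beltrami operator (trace of the Hessian):
`Δ f = ∑_ij g^ij (∂_i ∂_j f - ∑_k Γᵏ_ij ∂_k f)`. -/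
def laplacian (g : SmoothMetric m M) (f : M → ℝ) (p : M) : ℝ :=
  ∑ i, ∑ j, gUp g p (extChartAt (𝓡 m) p p) i j *
    (pd i (pd j (f ∘ (extChartAt (𝓡 m) p).symm)) (extChartAt (𝓡 m) p p)
      - ∑ k, christoffel g p k i j (extChartAt (𝓡 m) p p)
        * pd k (f ∘ (extChartAt (𝓡 m) p).symm) (extChartAt (𝓡 m) p p))

end OneManifold

section Maps

variable {m n : ℕ}
  {M : Type*} [TopologicalSpace M] [ChartedSpace (Coord m) M] [IsManifold (𝓡 m) ∞ M]
  {N : Type*} [TopologicalSpace N] [ChartedSpace (Coord n) N] [IsManifold (𝓡 n) ∞ N]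

/-- The `a`-th component `φᵃ` of `φ` in the charts around `p` and `φ p`. -/
def mapComp (φ : M → N) (p : M) (a : Fin n) (x : Coord m) : ℝ :=
  (writtenInExtChartAt (𝓡 m) (𝓡 n) p φ x : Coord n) a

/-- The components `Vᵃ` of a vector field `V` along `φ` (a section of `φ⁻¹TN`) in the charts
around `p` and `φ p`, so that `V = ∑_a Vᵃ (∂_a ∘ φ)` near `p`. -/
def secComp (φ : M → N) (V : ∀ q : M, TangentSpace (𝓡 n) (φ q)) (p : M) (a : Fin n)
    (x : Coord m) : ℝ :=
  comp (φ p) (φ ((extChartAt (𝓡 m) p).symm x)) (V ((extChartAt (𝓡 m) p).symm x)) a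

/-- The pull-back connection `∇^φ` in the charts around `p` and `φ p`: for a vector field along `φ`
with components `Wᵃ`, the components of its covariant derivative in the direction `∂_i` are
`∂_i Wᵃ + ∑_bc Γᵃ_bc(φ) (∂_i φᵇ) Wᶜ`. -/
def covPd (h : SmoothMetric n N) (φ : M → N) (p : M) (i : Fin m)
    (W : Fin n → Coord m → ℝ) (a : Fin n) (x : Coord m) : ℝ :=
  pd i (W a) x + ∑ b, ∑ c,
    christoffel h (φ p) a b c (writtenInExtChartAt (𝓡 m) (𝓡 n) p φ x)
      * pd i (mapComp φ p b) x * W c x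

/-- The tension field `τ(φ) = Trace_g ∇dφ`; in the charts around `p` and `φ p` the components of
`∇dφ(∂_i, ∂_j)` are those of `∇^φ_{∂_i} (dφ ∂_j) - dφ (∇^M_{∂_i} ∂_j)`. -/
def tension (g : SmoothMetric m M) (h : SmoothMetric n N) (φ : M → N) (p : M) :
    TangentSpace (𝓡 n) (φ p) :=
  ∑ a, (∑ i, ∑ j, gUp g p (extChartAt (𝓡 m) p p) i j *
    (covPd h φ p i (fun b => pd j (mapComp φ p b)) a (extChartAt (𝓡 m) p p)
      - ∑ k, christoffel g p k i j (extChartAt (𝓡 m) p p)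
        * pd k (mapComp φ p a) (extChartAt (𝓡 m) p p))) • coordVec (φ p) (φ p) a

/-- The covariant derivative `∇^φ_X V` at `p` of a vector field `V` along `φ`, for `X ∈ T_p M`. -/
def covDeriv (h : SmoothMetric n N) (φ : M → N) (V : ∀ q : M, TangentSpace (𝓡 n) (φ q))
    (p : M) (X : TangentSpace (𝓡 m) p) : TangentSpace (𝓡 n) (φ p) :=
  ∑ a, (∑ i, comp p p X i * covPd h φ p i (secComp φ V p) a (extChartAt (𝓡 m) p p))
    • coordVec (φ p) (φ p) a

/-- The rough Laplacian `Trace_g (∇^φ ∇^φ - ∇^φ_{∇^M}) V` of a vector field `V` along `φ`. -/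
def roughLaplacian (g : SmoothMetric m M) (h : SmoothMetric n N) (φ : M → N)
    (V : ∀ q : M, TangentSpace (𝓡 n) (φ q)) (p : M) : TangentSpace (𝓡 n) (φ p) :=
  ∑ a, (∑ i, ∑ j, gUp g p (extChartAt (𝓡 m) p p) i j *
    (covPd h φ p i (fun b => covPd h φ p j (secComp φ V p) b) a (extChartAt (𝓡 m) p p)
      - ∑ k, christoffel g p k i j (extChartAt (𝓡 m) p p)
        * covPd h φ p k (secComp φ V p) a (extChartAt (𝓡 m) p p))) • coordVec (φ p) (φ p) a

/-- The trace `Trace_g R^N(dφ, V) dφ = ∑_ij g^ij R^N(dφ ∂_i, V) dφ ∂_j`. -/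
def curvatureTrace (g : SmoothMetric m M) (h : SmoothMetric n N) (φ : M → N)
    (V : ∀ q : M, TangentSpace (𝓡 n) (φ q)) (p : M) : TangentSpace (𝓡 n) (φ p) :=
  ∑ i, ∑ j, gUp g p (extChartAt (𝓡 m) p p) i j •
    curvature h (φ p) (mfderiv (𝓡 m) (𝓡 n) φ p (coordVec p p i)) (V p)
      (mfderiv (𝓡 m) (𝓡 n) φ p (coordVec p p j))

/-- The bitension field
`τ₂(φ) = Trace_g (∇^φ ∇^φ - ∇^φ_{∇^M}) τ(φ) - Trace_g R^N(dφ, τ(φ)) dφ`. -/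
def bitension (g : SmoothMetric m M) (h : SmoothMetric n N) (φ : M → N) (p : M) :
    TangentSpace (𝓡 n) (φ p) :=
  roughLaplacian g h φ (tension g h φ) p - curvatureTrace g h φ (tension g h φ) p

/-- The `f`-bitension field `τ_{2,f}(φ) = f τ₂(φ) + (Δ f) τ(φ) + 2 ∇^φ_{grad f} τ(φ)`. -/
def fBitension (g : SmoothMetric m M) (h : SmoothMetric n N) (f : M → ℝ) (φ : M → N) (p : M) :
    TangentSpace (𝓡 n) (φ p) :=
  f p • bitension g h φ p + laplacian g f p • tension g h φ p
    + (2 : ℝ) • covDeriv h φ (tension g h φ) p (grad g f p)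

/-- `φ` is harmonic: its tension field vanishes identically. -/
def IsHarmonic (g : SmoothMetric m M) (h : SmoothMetric n N) (φ : M → N) : Prop :=
  ∀ p : M, tension g h φ p = 0

/-- `φ` is `f`-biharmonic: the Euler-Lagrange equation `τ_{2,f}(φ) = 0` of the `f`-bienergy
`½ ∫ f |τ(φ)|²` holds on all of `M`. -/
def IsFBiharmonic (g : SmoothMetric m M) (h : SmoothMetric n N) (f : M → ℝ) (φ : M → N) : Prop :=
  ∀ p : M, fBitension g h f φ p = 0

end Maps

end FBiharmonic

end

/-!
Testing the equation at a point `p` with `f = 1` gives `τ₂(φ)(p) = 0`. Testing it next with a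
positive function `f` that is `1 + |x - x(p)|²` in a chart `x` near `p` kills the gradient term as
well, because `p` is a critical point of `f`; what remains is `(Δ f)(p) τ(φ)(p) = 0`, where
`(Δ f)(p) = 2 ∑ᵢ gⁱⁱ(p) > 0` as soon as `M` has positive dimension.
-/

open scoped Topology

namespace FBiharmonic

section PositiveExtension

variable {E : Type*} [NormedAddCommGroup E] [NormedSpace ℝ E] [FiniteDimensional ℝ E]
  {H : Type*} [TopologicalSpace H] {I : ModelWithCorners ℝ E H}
  {M : Type*} [TopologicalSpace M] [ChartedSpace H M] [IsManifold I ∞ M] [T2Space M]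

lemma exists_contMDiff_pos_eventuallyEq {u : M → ℝ} {p : M}
    (hu : ContMDiffOn I 𝓘(ℝ, ℝ) ∞ u (chartAt H p).source)
    (hpos : ∀ q ∈ (chartAt H p).source, 0 < u q) :
    ∃ f : M → ℝ, ContMDiff I 𝓘(ℝ, ℝ) ∞ f ∧ (∀ q, 0 < f q) ∧ f =ᶠ[𝓝 p] u := by
  let χ : SmoothBumpFunction I p := Classical.arbitrary _
  refine ⟨fun q => 1 + χ q • (u q - 1), ?_, fun q => ?_, ?_⟩
  · exact contMDiff_const.add (χ.contMDiff_smul (hu.sub contMDiffOn_const))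
  · by_cases hq : q ∈ Function.support χ
    · have hχ_pos : 0 < χ q := χ.nonneg.lt_of_ne' hq
      have hχ_le : χ q ≤ 1 := χ.le_one
      have hu_pos : 0 < u q := hpos q (χ.support_subset_source hq)
      calc 0 < (1 - χ q) + χ q * u q :=
            add_pos_of_nonneg_of_pos (sub_nonneg.2 hχ_le) (mul_pos hχ_pos hu_pos)
        _ = 1 + χ q • (u q - 1) := by rw [smul_eq_mul]; ring
    · simp [Function.notMem_support.1 hq]
  · filter_upwards [χ.eventuallyEq_one] with q hq
    simp [hq]

lemma exists_contMDiff_pos_comp_extChartAt_symm_eventuallyEq [I.Boundaryless] {u : E → ℝ} (p : M)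
    (hu : ContDiffOn ℝ ∞ u (extChartAt I p).target)
    (hpos : ∀ x ∈ (extChartAt I p).target, 0 < u x) :
    ∃ f : M → ℝ, ContMDiff I 𝓘(ℝ, ℝ) ∞ f ∧ (∀ q, 0 < f q) ∧
      f ∘ (extChartAt I p).symm =ᶠ[𝓝 (extChartAt I p p)] u := by
  have hmaps : Set.MapsTo (extChartAt I p) (chartAt H p).source (extChartAt I p).target := by
    simpa only [extChartAt_source] using (extChartAt I p).mapsTo
  obtain ⟨f, hf, hf_pos, hfu⟩ := exists_contMDiff_pos_eventuallyEq
    (hu.contMDiffOn.comp contMDiffOn_extChartAt hmaps) fun q hq => hpos _ (hmaps hq)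
  have hsymm : Filter.Tendsto (extChartAt I p).symm (𝓝 (extChartAt I p p)) (𝓝 p) := by
    simpa only [ContinuousAt, extChartAt_to_inv] using continuousAt_extChartAt_symm (I := I) p
  refine ⟨f, hf, hf_pos, ?_⟩
  filter_upwards [hsymm.eventually hfu, extChartAt_target_mem_nhds (I := I) p] with x hx hx_target
  simpa only [Function.comp_apply, (extChartAt I p).right_inv hx_target] using hx

end PositiveExtension

section PartialDerivatives

variable {m : ℕ}

lemma pd_congr {u v : Coord m → ℝ} {x : Coord m} (huv : u =ᶠ[𝓝 x] v) (i : Fin m) :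
    pd i u =ᶠ[𝓝 x] pd i v := by
  filter_upwards [huv.eventuallyEq_nhds] with y hy
  rw [pd, pd, hy.fderiv_eq]

lemma pd_const (i : Fin m) (c : ℝ) : pd i (fun _ => c) = fun _ => 0 := by
  funext x
  simp [pd]

lemma pd_const_add_norm_sub_sq (j : Fin m) (c : ℝ) (x₀ : Coord m) :
    pd j (fun x => c + ‖x - x₀‖ ^ 2) = fun x => 2 * (x j - x₀ j) := by
  funext x
  have hderiv := (((hasFDerivAt_id x).sub_const x₀).norm_sq).const_add c
  simp only [id_eq] at hderiv
  rw [pd, hderiv.fderiv]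
  simp [EuclideanSpace.inner_single_right]

lemma pd_const_mul_apply_sub (i j : Fin m) (a c : ℝ) (x : Coord m) :
    pd i (fun y => a * (y j - c)) x = if j = i then a else 0 := by
  have hderiv : HasFDerivAt (fun y : Coord m => a * (y j - c))
      (a • (EuclideanSpace.proj j : Coord m →L[ℝ] ℝ)) x :=
    ((EuclideanSpace.proj j : Coord m →L[ℝ] ℝ).hasFDerivAt.sub_const c).const_mul a
  rw [pd, hderiv.fderiv]
  simp

end PartialDerivatives

section Metric

variable {m : ℕ} {M : Type*} [TopologicalSpace M] [ChartedSpace (Coord m) M]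
  [IsManifold (𝓡 m) ∞ M]

lemma comp_zero (p q : M) (i : Fin m) : comp p q (0 : TangentSpace (𝓡 m) q) i = 0 := by
  simp [comp]

lemma comp_sum_smul_coordVec {p q : M} (hq : q ∈ (chartAt (Coord m) p).source)
    (v : Fin m → ℝ) (k : Fin m) : comp p q (∑ i, v i • coordVec p q i) k = v k := by
  have hbase : q ∈ (trivializationAt (Coord m) (TangentSpace (𝓡 m) : M → Type _) p).baseSet := by
    rwa [TangentBundle.trivializationAt_baseSet]
  simp only [comp, coordVec, ← map_smul, ← map_sum]
  rw [Bundle.Trivialization.continuousLinearMapAt_symmL _ hbase]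
  simp [Pi.single_apply]

lemma inner_sum_smul_coordVec (g : SmoothMetric m M) (p : M) (x : Coord m) (v : Fin m → ℝ) :
    g.inner ((extChartAt (𝓡 m) p).symm x)
        (∑ i, v i • coordVec p ((extChartAt (𝓡 m) p).symm x) i)
        (∑ i, v i • coordVec p ((extChartAt (𝓡 m) p).symm x) i) =
      v ⬝ᵥ (gLow g p x).mulVec v := by
  simp only [map_sum, map_smul, _root_.sum_apply, _root_.smul_apply, dotProduct, Matrix.mulVec,
    gLow, Matrix.of_apply, smul_eq_mul, Finset.mul_sum]
  rw [Finset.sum_comm]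
  refine Finset.sum_congr rfl fun i _ => Finset.sum_congr rfl fun j _ => ?_
  ring

lemma gLow_posDef (g : SmoothMetric m M) (p : M) {x : Coord m}
    (hx : x ∈ (extChartAt (𝓡 m) p).target) : (gLow g p x).PosDef := by
  refine Matrix.PosDef.of_dotProduct_mulVec_pos ?_ fun v hv => ?_
  · ext i j
    exact g.symm _ _ _
  · have hsource : (extChartAt (𝓡 m) p).symm x ∈ (chartAt (Coord m) p).source := by
      rw [← extChartAt_source (𝓡 m)]
      exact (extChartAt (𝓡 m) p).map_target hx
    rw [star_trivial, ← inner_sum_smul_coordVec]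
    refine g.pos _ _ fun hzero => hv (funext fun k => ?_)
    rw [← comp_sum_smul_coordVec hsource v k, hzero, comp_zero, Pi.zero_apply]

lemma trace_gUp_pos [NeZero m] (g : SmoothMetric m M) (p : M) {x : Coord m}
    (hx : x ∈ (extChartAt (𝓡 m) p).target) : 0 < (gUp g p x).trace :=
  (gLow_posDef g p hx).inv.trace_pos

end Metric

section GradientLaplacian

variable {m : ℕ} {M : Type*} [TopologicalSpace M] [ChartedSpace (Coord m) M]
  [IsManifold (𝓡 m) ∞ M]

lemma grad_eq_zero_of_pd_eq_zero (g : SmoothMetric m M) {f : M → ℝ} {p : M}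
    (hf : ∀ j, pd j (f ∘ (extChartAt (𝓡 m) p).symm) (extChartAt (𝓡 m) p p) = 0) :
    grad g f p = 0 := by
  simp only [grad, hf, mul_zero, Finset.sum_const_zero, zero_smul]

lemma laplacian_of_pd_eq_zero (g : SmoothMetric m M) {f : M → ℝ} {p : M}
    (hf : ∀ j, pd j (f ∘ (extChartAt (𝓡 m) p).symm) (extChartAt (𝓡 m) p p) = 0) :
    laplacian g f p = ∑ i, ∑ j, gUp g p (extChartAt (𝓡 m) p p) i j *
      pd i (pd j (f ∘ (extChartAt (𝓡 m) p).symm)) (extChartAt (𝓡 m) p p) := by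
  simp only [laplacian, hf, mul_zero, Finset.sum_const_zero, sub_zero]

lemma grad_const (g : SmoothMetric m M) (c : ℝ) (p : M) : grad g (fun _ => c) p = 0 :=
  grad_eq_zero_of_pd_eq_zero g fun j => congrFun (pd_const j c) _

lemma laplacian_const (g : SmoothMetric m M) (c : ℝ) (p : M) :
    laplacian g (fun _ => c) p = 0 := by
  have hpd (j : Fin m) : pd j ((fun _ : M => c) ∘ (extChartAt (𝓡 m) p).symm) = fun _ => 0 :=
    pd_const j c
  rw [laplacian_of_pd_eq_zero g fun j => congrFun (hpd j) _]
  simp only [hpd, pd_const, mul_zero, Finset.sum_const_zero]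

lemma exists_pos_grad_eq_zero_laplacian_eq [T2Space M] (g : SmoothMetric m M) (p : M) :
    ∃ f : M → ℝ, ContMDiff (𝓡 m) 𝓘(ℝ, ℝ) ∞ f ∧ (∀ q, 0 < f q) ∧ grad g f p = 0 ∧
      laplacian g f p = 2 * (gUp g p (extChartAt (𝓡 m) p p)).trace := by
  set x₀ := extChartAt (𝓡 m) p p with hx₀
  obtain ⟨f, hf, hf_pos, hchart⟩ := exists_contMDiff_pos_comp_extChartAt_symm_eventuallyEq
    (I := 𝓡 m) (u := fun x => 1 + ‖x - x₀‖ ^ 2) p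
    (contDiff_const.add ((contDiff_id.sub contDiff_const).norm_sq ℝ)).contDiffOn
    fun _ _ => by positivity
  have hpd (j : Fin m) :
      pd j (f ∘ (extChartAt (𝓡 m) p).symm) =ᶠ[𝓝 x₀] fun x => 2 * (x j - x₀ j) := by
    simpa only [pd_const_add_norm_sub_sq] using pd_congr hchart j
  have hcrit (j : Fin m) : pd j (f ∘ (extChartAt (𝓡 m) p).symm) x₀ = 0 := by
    rw [(hpd j).eq_of_nhds, sub_self, mul_zero]
  have hhess (i j : Fin m) :
      pd i (pd j (f ∘ (extChartAt (𝓡 m) p).symm)) x₀ = if j = i then 2 else 0 := by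
    rw [(pd_congr (hpd j) i).eq_of_nhds, pd_const_mul_apply_sub]
  refine ⟨f, hf, hf_pos, grad_eq_zero_of_pd_eq_zero g hcrit, ?_⟩
  rw [laplacian_of_pd_eq_zero g hcrit, ← hx₀]
  simp only [hhess, mul_ite, mul_zero, Finset.sum_ite_eq', Finset.mem_univ, if_true,
    ← Finset.sum_mul]
  exact mul_comm _ _

end GradientLaplacian

section PullbackConnection

variable {m n : ℕ} {M : Type*} [TopologicalSpace M] [ChartedSpace (Coord m) M]
  {N : Type*} [TopologicalSpace N] [ChartedSpace (Coord n) N] [IsManifold (𝓡 n) ∞ N]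

lemma secComp_zero (φ : M → N) (p : M) :
    secComp (m := m) (n := n) φ (fun _ => 0) p = fun _ _ => 0 := by
  funext a x
  exact comp_zero _ _ a

lemma covPd_zero (h : SmoothMetric n N) (φ : M → N) (p : M) (i : Fin m) :
    covPd (m := m) h φ p i (fun _ _ => 0) = fun _ _ => 0 := by
  funext a x
  simp [covPd, pd_const]

end PullbackConnection

section Maps

variable {m n : ℕ}
  {M : Type*} [TopologicalSpace M] [ChartedSpace (Coord m) M] [IsManifold (𝓡 m) ∞ M]
  {N : Type*} [TopologicalSpace N] [ChartedSpace (Coord n) N] [IsManifold (𝓡 n) ∞ N]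

lemma covDeriv_zero_section (h : SmoothMetric n N) (φ : M → N) (p : M)
    (X : TangentSpace (𝓡 m) p) : covDeriv h φ (fun _ => 0) p X = 0 := by
  simp [covDeriv, secComp_zero, covPd_zero]

lemma covDeriv_zero_direction (h : SmoothMetric n N) (φ : M → N)
    (V : ∀ q : M, TangentSpace (𝓡 n) (φ q)) (p : M) :
    covDeriv h φ V p (0 : TangentSpace (𝓡 m) p) = 0 := by
  simp [covDeriv, comp_zero]

lemma roughLaplacian_zero (g : SmoothMetric m M) (h : SmoothMetric n N) (φ : M → N) (p : M) :
    roughLaplacian g h φ (fun _ => 0) p = 0 := by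
  simp [roughLaplacian, secComp_zero, covPd_zero]

lemma curvatureTrace_zero (g : SmoothMetric m M) (h : SmoothMetric n N) (φ : M → N) (p : M) :
    curvatureTrace g h φ (fun _ => 0) p = 0 := by
  simp [curvatureTrace, curvature, comp_zero]

lemma IsHarmonic.isFBiharmonic {g : SmoothMetric m M} {h : SmoothMetric n N} {φ : M → N}
    (hφ : IsHarmonic g h φ) (f : M → ℝ) : IsFBiharmonic g h f φ := by
  have hτ : tension g h φ = fun _ => 0 := funext hφ
  intro p
  simp only [fBitension, bitension, hτ, roughLaplacian_zero, curvatureTrace_zero,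
    covDeriv_zero_section, sub_zero, smul_zero, add_zero]

lemma fBitension_of_grad_eq_zero {g : SmoothMetric m M} {f : M → ℝ} {p : M}
    (hf : grad g f p = 0) (h : SmoothMetric n N) (φ : M → N) :
    fBitension g h f φ p = f p • bitension g h φ p + laplacian g f p • tension g h φ p := by
  rw [fBitension, hf, covDeriv_zero_direction, smul_zero, add_zero]

lemma fBitension_const (g : SmoothMetric m M) (h : SmoothMetric n N) (c : ℝ) (φ : M → N) (p : M) :
    fBitension g h (fun _ => c) φ p = c • bitension g h φ p := by
  rw [fBitension_of_grad_eq_zero (grad_const g c p), laplacian_const, zero_smul, add_zero]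

lemma tension_of_dim_eq_zero (hm : m = 0) (g : SmoothMetric m M) (h : SmoothMetric n N)
    (φ : M → N) (p : M) : tension g h φ p = 0 := by
  subst hm
  simp [tension]

lemma tension_eq_zero_of_forall_fBitension_eq_zero [T2Space M] {g : SmoothMetric m M}
    {h : SmoothMetric n N} {φ : M → N} {p : M}
    (hφ : ∀ f : M → ℝ, ContMDiff (𝓡 m) 𝓘(ℝ, ℝ) ∞ f → (∀ q, 0 < f q) → fBitension g h f φ p = 0) :
    tension g h φ p = 0 := by
  rcases eq_or_ne m 0 with hm | hm
  · exact tension_of_dim_eq_zero hm g h φ p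
  have : NeZero m := ⟨hm⟩
  have hτ₂ : bitension g h φ p = 0 := by
    simpa only [fBitension_const, one_smul] using
      hφ (fun _ => 1) contMDiff_const fun _ => one_pos
  obtain ⟨f, hf, hf_pos, hgrad, hΔ⟩ := exists_pos_grad_eq_zero_laplacian_eq g p
  have hΔ_pos : 0 < laplacian g f p :=
    hΔ ▸ mul_pos two_pos (trace_gUp_pos g p (mem_extChartAt_target p))
  have hΔτ : laplacian g f p • tension g h φ p = 0 := by
    simpa only [fBitension_of_grad_eq_zero hgrad, hτ₂, smul_zero, zero_add] using hφ f hf hf_pos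
  exact (smul_eq_zero.1 hΔτ).resolve_left hΔ_pos.ne'

end Maps

end FBiharmonic

theorem theorem2p2_general {m n : ℕ}
    {M : Type*} [TopologicalSpace M] [T2Space M] [ChartedSpace (EuclideanSpace ℝ (Fin m)) M]
    [IsManifold (𝓡 m) ∞ M]
    {N : Type*} [TopologicalSpace N] [ChartedSpace (EuclideanSpace ℝ (Fin n)) N]
    [IsManifold (𝓡 n) ∞ N]
    (g : FBiharmonic.SmoothMetric m M) (h : FBiharmonic.SmoothMetric n N)
    (φ : M → N) (_hφ : ContMDiff (𝓡 m) (𝓡 n) 4 φ) :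
    FBiharmonic.IsHarmonic g h φ ↔
      ∀ f : M → ℝ, ContMDiff (𝓡 m) 𝓘(ℝ, ℝ) ∞ f → (∀ p : M, 0 < f p) →
        FBiharmonic.IsFBiharmonic g h f φ :=
  ⟨fun hharm f _ _ => hharm.isFBiharmonic f, fun hbi _ =>
    FBiharmonic.tension_eq_zero_of_forall_fBitension_eq_zero fun f hf hf_pos => hbi f hf hf_pos _⟩

theorem theorem2p2 {m n : ℕ}
    {M : Type*} [TopologicalSpace M] [T2Space M] [ChartedSpace (EuclideanSpace ℝ (Fin m)) M]
    [IsManifold (𝓡 m) ∞ M]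
    {N : Type*} [TopologicalSpace N] [T2Space N] [ChartedSpace (EuclideanSpace ℝ (Fin n)) N]
    [IsManifold (𝓡 n) ∞ N]
    (g : FBiharmonic.SmoothMetric m M) (h : FBiharmonic.SmoothMetric n N)
    (φ : M → N) (hφ : ContMDiff (𝓡 m) (𝓡 n) ∞ φ) :
    FBiharmonic.IsHarmonic g h φ ↔
      ∀ f : M → ℝ, ContMDiff (𝓡 m) 𝓘(ℝ, ℝ) ∞ f → (∀ p : M, 0 < f p) →
        FBiharmonic.IsFBiharmonic g h f φ := by
  exact theorem2p2_general g h φ (hφ.of_le (WithTop.coe_le_coe.2 le_top))
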